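/- Let $\mathcal C$ be any categorical model of Martin-Löf type theory with dependent products $\Pi$ (with the $\eta$-rule for functions), dependent sums $\Sigma$, identity types $\mathrm{Id}$, function extensionality, a type $\mathsf{Nat}$ of natural numbers, and a universe $\mathsf U$ containing $\mathsf{Nat}$ and closed under $\Pi$, $\Sigma$ and $\mathrm{Id}$; that is, let $\mathcal C$ be a contextual category (whose objects $\Gamma$ are called contexts and which has context extensions $\Gamma.A$ with projections $\Gamma.A\to\Gamma$, and strictly functorial substitution) together with operations, stable under substitution, interpreting the formation, introduction, elimination and computation rules of these types and the function extensionality axiom. (No $\eta$-rule for $\Sigma$-types is assumed.) Call a map of $\mathcal C$ a *fibration* if it is isomorphic, in the arrow category, to a finite (possibly empty) composite of dependent projections $\Gamma.A\to\Gamma$. For a map $f\colon A\to B$ between closed types put $\mathrm{hfib}(f,y)=\Sigma_{x:A}\,\mathrm{Id}(f(x),y)$ and $\mathrm{isContr}(X)=\Sigma_{x_0:X}\Pi_{x:X}\,\mathrm{Id}(x,x_0)$, and call $f$ a *weak equivalence* if the closed type $\Pi_{y:B}\,\mathrm{isContr}(\mathrm{hfib}(f,y))$ has a term in $\mathcal C$.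 For a map $f\colon\Gamma\to\Delta$ between arbitrary contexts, let $|\Gamma|$ denote the iterated $\Sigma$-type of $\Gamma$ (the type itself for a context of length one, and the unit type $\Sigma_{n:\mathsf{Nat}}\mathrm{Id}(n,0)$ for the empty context), and call $f$ a weak equivalence if the composite $|\Gamma|\to\Gamma\xrightarrow{f}\Delta\to|\Delta|$ of $f$ with the canonical projection and tupling maps is one. Then $\mathcal C$, with the classes $\mathcal W$ of weak equivalences and $\mathcal F$ of fibrations, is a fibration category: 1. $\mathcal W$ satisfies 2-out-of-6: for composable $f,g,h$, if $g\cdot f$ and $h\cdot g$ are in $\mathcal W$, then so are $f$, $g$, $h$ and $h\cdot g\cdot f$. 2. $\mathcal F$ is closed under composition. 3. All isomorphisms are acyclic fibrations, i.e. lie in $\mathcal W\cap\mathcal F$. 4. $\mathcal C$ has a terminal object $1$. 5. Pullbacks along fibrations exist, and fibrations and acyclic fibrations are stable under pullback. 6. For every object $X$ the product $X\times X$ exists and the diagonal $X\to X\times X$ factors as a weak equivalence followed by a fibration. 7. Every object is fibrant: $X\to 1$ is a fibration for every $X$. -/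

import Mathlib

open CategoryTheory CategoryTheory.Limits

universe w v u

noncomputable section

namespace ModelsOfTypeTheory

/-! ## Contextual categories -/

/-- The structure of contexts, types, context extension and (strictly functorial) substitution on a
category `C`, whose objects are thought of as contexts and whose maps as context morphisms.
`ext A` is the extended context `Γ.A`, `p A : Γ.A ⟶ Γ` its dependent projection, `sub A σ` is the
type `A[σ]`, and `q σ A : Δ.A[σ] ⟶ Γ.A` is the canonical map over `σ`. -/
class ContextStructure (C : Type u) [Category.{v} C] where
  /-- the empty context -/
  one : C
  oneIsTerminal : IsTerminal one
  Ty : C → Type w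
  ext {Γ : C} (A : Ty Γ) : C
  p {Γ : C} (A : Ty Γ) : ext A ⟶ Γ
  sub {Δ Γ : C} (A : Ty Γ) (σ : Δ ⟶ Γ) : Ty Δ
  q {Δ Γ : C} (σ : Δ ⟶ Γ) (A : Ty Γ) : ext (sub A σ) ⟶ ext A
  isPullback {Δ Γ : C} (σ : Δ ⟶ Γ) (A : Ty Γ) : IsPullback (q σ A) (p (sub A σ)) (p A) σ
  sub_id {Γ : C} (A : Ty Γ) : sub A (𝟙 Γ) = A
  sub_comp {Θ Δ Γ : C} (τ : Θ ⟶ Δ) (σ : Δ ⟶ Γ) (A : Ty Γ) : sub A (τ ≫ σ) = sub (sub A σ) τ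
  q_id {Γ : C} (A : Ty Γ) : q (𝟙 Γ) A = eqToHom (congrArg ext (sub_id A))
  q_comp {Θ Δ Γ : C} (τ : Θ ⟶ Δ) (σ : Δ ⟶ Γ) (A : Ty Γ) :
    q (τ ≫ σ) A = eqToHom (congrArg ext (sub_comp τ σ A)) ≫ q τ (sub A σ) ≫ q σ A

open ContextStructure

/-- A presentation of the object `Γ` as an iterated extension `1.A₁.….Aₙ` of the empty context. -/
inductive Tower {C : Type u} [Category.{v} C] [ContextStructure.{w} C] : C → Type (max u w)
  | nil : Tower (one : C)
  | snoc {Γ : C} (t : Tower Γ) (A : Ty Γ) : Tower (ext A)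

/-- A contextual category: every object is, in a unique way, an iterated extension of the empty
context. (Equivalently, there is a length function on objects, `one` is the only object of length
zero, and every object `X` of length `n + 1` is `ext A` for a unique `Γ` of length `n`, the "father"
of `X`, and a unique `A : Ty Γ`; so `Ty Γ` is the set of objects whose father is `Γ`.) -/
class ContextualCategory (C : Type u) [Category.{v} C] extends ContextStructure.{w} C where
  tower (Γ : C) : Tower Γ
  tower_unique {Γ : C} (t : Tower Γ) : t = tower Γ

section Basics

variable {C : Type u} [Category.{v} C] [ContextStructure.{w} C]

/-- The unique map to the empty context. -/
def toOne (Γ : C) : Γ ⟶ (one : C) := oneIsTerminal.from Γ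

theorem toOne_ext {Γ : C} (f g : Γ ⟶ (one : C)) : f = g := oneIsTerminal.hom_ext f g

/-- The canonical map `Δ.A' ⟶ Γ.A` over `σ`, when `A'` is equal to `A[σ]`. -/
def qOf {Δ Γ : C} (σ : Δ ⟶ Γ) (A : Ty Γ) (A' : Ty Δ) (e : sub A σ = A') : ext A' ⟶ ext A :=
  eqToHom (congrArg ext e.symm) ≫ q σ A

/-- The map `Δ ⟶ Γ.A[σ]` determined by a map to `Γ.A` and a map to the base. -/
def pair {X Δ Γ : C} (σ : Δ ⟶ Γ) (A : Ty Γ) (a : X ⟶ ext A) (f : X ⟶ Δ) (h : a ≫ p A = f ≫ σ) :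
    X ⟶ ext (sub A σ) :=
  (isPullback σ A).lift a f h

theorem pair_q {X Δ Γ : C} (σ : Δ ⟶ Γ) (A : Ty Γ) (a : X ⟶ ext A) (f : X ⟶ Δ)
    (h : a ≫ p A = f ≫ σ) : pair σ A a f h ≫ q σ A = a :=
  (isPullback σ A).lift_fst a f h

theorem pair_p {X Δ Γ : C} (σ : Δ ⟶ Γ) (A : Ty Γ) (a : X ⟶ ext A) (f : X ⟶ Δ)
    (h : a ≫ p A = f ≫ σ) : pair σ A a f h ≫ p (sub A σ) = f :=
  (isPullback σ A).lift_snd a f h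

theorem q_p {Δ Γ : C} (σ : Δ ⟶ Γ) (A : Ty Γ) : q σ A ≫ p A = p (sub A σ) ≫ σ :=
  (isPullback σ A).w

/-- Terms of type `A` in context `Γ`: sections of the dependent projection `p A`. -/
structure Tm {Γ : C} (A : Ty Γ) where
  hom : Γ ⟶ ext A
  hom_p : hom ≫ p A = 𝟙 Γ

/-- The term `s[σ]`. -/
def Tm.sub {Δ Γ : C} {A : Ty Γ} (s : Tm A) (σ : Δ ⟶ Γ) : Tm (ContextStructure.sub A σ) where
  hom := pair σ A (σ ≫ s.hom) (𝟙 Δ) (by rw [Category.assoc, s.hom_p]; simp)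
  hom_p := pair_p _ _ _ _ _

/-- Transport of terms along an equality of types. -/
def Tm.cast {Γ : C} {A A' : Ty Γ} (s : Tm A) (e : A = A') : Tm A' := e ▸ s

/-- The variable `Γ, x : A ⊢ x : A`. -/
def var {Γ : C} (A : Ty Γ) : Tm (sub A (p A)) where
  hom := pair (p A) A (𝟙 _) (𝟙 _) rfl
  hom_p := pair_p _ _ _ _ _

/-- The judgement "`s'` is `s[σ]`" (including that the type of `s'` is `A[σ]`). -/
def IsSubst {Δ Γ : C} (σ : Δ ⟶ Γ) {A : Ty Γ} {A' : Ty Δ} (s : Tm A) (s' : Tm A') : Prop :=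
  ∃ e : sub A σ = A', s'.hom ≫ qOf σ A A' e = σ ≫ s.hom

/-- The map `⟨a, b⟩ : X ⟶ Γ.A.A`, for maps `a b : X ⟶ Γ.A` over the same map to `Γ`. -/
def pair₂ {X Γ : C} {A : Ty Γ} (a b : X ⟶ ext A) (h : a ≫ p A = b ≫ p A) :
    X ⟶ ext (sub A (p A)) :=
  pair (p A) A b a h.symm

/-- The canonical map `Δ.A[σ].A[σ] ⟶ Γ.A.A` over `σ`. -/
def q₂ {Δ Γ : C} (σ : Δ ⟶ Γ) (A : Ty Γ) :
    ext (sub (sub A σ) (p (sub A σ))) ⟶ ext (sub A (p A)) :=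
  pair₂ (p (sub (sub A σ) (p (sub A σ))) ≫ q σ A) (q (p (sub A σ)) (sub A σ) ≫ q σ A) (by
    rw [Category.assoc, Category.assoc, q_p, ← Category.assoc, ← Category.assoc, q_p])

end Basics

/-! ## Type constructors

All the rules are given for an arbitrary context `Γ`, and all of them are stable under substitution
along an arbitrary map `σ : Δ ⟶ Γ`. -/

/-- Dependent products: formation, introduction (`lam`), elimination (`app`), computation. For terms
`k` of `Π A B` and `a` of `A`, the term `app k a` of `B[a]` is given as a map `Γ ⟶ Γ.A.B` over
`a : Γ ⟶ Γ.A`. -/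
class PiTypes (C : Type u) [Category.{v} C] [ContextStructure.{w} C] where
  Pi {Γ : C} (A : Ty Γ) (B : Ty (ext A)) : Ty Γ
  Pi_sub {Δ Γ : C} (σ : Δ ⟶ Γ) (A : Ty Γ) (B : Ty (ext A)) :
    sub (Pi A B) σ = Pi (sub A σ) (sub B (q σ A))
  lam {Γ : C} {A : Ty Γ} {B : Ty (ext A)} (b : Tm B) : Tm (Pi A B)
  lam_sub {Δ Γ : C} (σ : Δ ⟶ Γ) {A : Ty Γ} {B : Ty (ext A)} (b : Tm B)
    (b' : Tm (sub B (q σ A))) : IsSubst (q σ A) b b' → IsSubst σ (lam b) (lam b')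
  app {Γ : C} {A : Ty Γ} {B : Ty (ext A)} (k : Tm (Pi A B)) (a : Tm A) : Γ ⟶ ext B
  app_p {Γ : C} {A : Ty Γ} {B : Ty (ext A)} (k : Tm (Pi A B)) (a : Tm A) :
    app k a ≫ p B = a.hom
  app_sub {Δ Γ : C} (σ : Δ ⟶ Γ) {A : Ty Γ} {B : Ty (ext A)} (k : Tm (Pi A B)) (a : Tm A)
    (k' : Tm (Pi (sub A σ) (sub B (q σ A)))) (a' : Tm (sub A σ)) :
    IsSubst σ k k' → IsSubst σ a a' → app k' a' ≫ q (q σ A) B = σ ≫ app k a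
  beta {Γ : C} {A : Ty Γ} {B : Ty (ext A)} (b : Tm B) (a : Tm A) :
    app (lam b) a = a.hom ≫ b.hom

/-- Dependent sums: formation, introduction (`tuple` is the pairing `x : A, y : B ⊢ (x, y) : Σ A B`, as
a map `Γ.A.B ⟶ Γ.(Σ A B)` over `Γ`), dependent elimination (`split`) and computation. -/
class SigmaTypes (C : Type u) [Category.{v} C] [ContextStructure.{w} C] where
  Sig {Γ : C} (A : Ty Γ) (B : Ty (ext A)) : Ty Γ
  Sig_sub {Δ Γ : C} (σ : Δ ⟶ Γ) (A : Ty Γ) (B : Ty (ext A)) :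
    sub (Sig A B) σ = Sig (sub A σ) (sub B (q σ A))
  tuple {Γ : C} (A : Ty Γ) (B : Ty (ext A)) : ext B ⟶ ext (Sig A B)
  tuple_p {Γ : C} (A : Ty Γ) (B : Ty (ext A)) : tuple A B ≫ p (Sig A B) = p B ≫ p A
  tuple_sub {Δ Γ : C} (σ : Δ ⟶ Γ) (A : Ty Γ) (B : Ty (ext A)) :
    tuple (sub A σ) (sub B (q σ A)) ≫ qOf σ (Sig A B) _ (Sig_sub σ A B) = q (q σ A) B ≫ tuple A B
  split {Γ : C} {A : Ty Γ} {B : Ty (ext A)} (D : Ty (ext (Sig A B))) (d : ext B ⟶ ext D)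
    (hd : d ≫ p D = tuple A B) : Tm D
  tuple_split {Γ : C} {A : Ty Γ} {B : Ty (ext A)} (D : Ty (ext (Sig A B))) (d : ext B ⟶ ext D)
    (hd : d ≫ p D = tuple A B) : tuple A B ≫ (split D d hd).hom = d
  split_sub {Δ Γ : C} (σ : Δ ⟶ Γ) {A : Ty Γ} {B : Ty (ext A)} (D : Ty (ext (Sig A B)))
    (d : ext B ⟶ ext D) (hd : d ≫ p D = tuple A B)
    (d' : ext (sub B (q σ A)) ⟶ ext (sub D (qOf σ (Sig A B) _ (Sig_sub σ A B))))
    (hd' : d' ≫ p _ = tuple (sub A σ) (sub B (q σ A))) :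
    d' ≫ q _ D = q (q σ A) B ≫ d →
      (split _ d' hd').hom ≫ q _ D = qOf σ (Sig A B) _ (Sig_sub σ A B) ≫ (split D d hd).hom

/-- Identity types: formation (`x y : A ⊢ Id x y`, a type `IdF A` over `Γ.A.A`), introduction
(`x : A ⊢ refl x : Id x x`, a map `Γ.A ⟶ Γ.A.A.Id` over the diagonal), elimination (`J`) and
computation. -/
class IdTypes (C : Type u) [Category.{v} C] [ContextStructure.{w} C] where
  IdF {Γ : C} (A : Ty Γ) : Ty (ext (sub A (p A)))
  IdF_sub {Δ Γ : C} (σ : Δ ⟶ Γ) (A : Ty Γ) : sub (IdF A) (q₂ σ A) = IdF (sub A σ)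
  refl {Γ : C} (A : Ty Γ) : ext A ⟶ ext (IdF A)
  refl_p {Γ : C} (A : Ty Γ) : refl A ≫ p (IdF A) = pair₂ (𝟙 _) (𝟙 _) rfl
  refl_sub {Δ Γ : C} (σ : Δ ⟶ Γ) (A : Ty Γ) :
    refl (sub A σ) ≫ qOf (q₂ σ A) (IdF A) _ (IdF_sub σ A) = q σ A ≫ refl A
  J {Γ : C} {A : Ty Γ} (D : Ty (ext (IdF A))) (d : ext A ⟶ ext D) (hd : d ≫ p D = refl A) : Tm D
  refl_J {Γ : C} {A : Ty Γ} (D : Ty (ext (IdF A))) (d : ext A ⟶ ext D)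
    (hd : d ≫ p D = refl A) : refl A ≫ (J D d hd).hom = d
  J_sub {Δ Γ : C} (σ : Δ ⟶ Γ) {A : Ty Γ} (D : Ty (ext (IdF A))) (d : ext A ⟶ ext D)
    (hd : d ≫ p D = refl A)
    (d' : ext (sub A σ) ⟶ ext (sub D (qOf (q₂ σ A) (IdF A) _ (IdF_sub σ A))))
    (hd' : d' ≫ p _ = refl (sub A σ)) :
    d' ≫ q _ D = q σ A ≫ d →
      (J _ d' hd').hom ≫ q _ D = qOf (q₂ σ A) (IdF A) _ (IdF_sub σ A) ≫ (J D d hd).hom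

open PiTypes SigmaTypes IdTypes

/-- The type `Id a b` over `X`, for maps `a b : X ⟶ Γ.A` over the same map `X ⟶ Γ`. -/
def IdTy {C : Type u} [Category.{v} C] [ContextStructure.{w} C] [IdTypes C] {X Γ : C} {A : Ty Γ}
    (a b : X ⟶ ext A) (h : a ≫ p A = b ≫ p A) : Ty X :=
  sub (IdF A) (pair₂ a b h)

/-- For a term `k` of `Π A B`, the term `x : A ⊢ k x : B`. -/
def ev {C : Type u} [Category.{v} C] [ContextStructure.{w} C] [PiTypes C] {Γ : C} {A : Ty Γ}
    {B : Ty (ext A)} (k : Tm (Pi A B)) : Tm B where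
  hom := app ((k.sub (p A)).cast (Pi_sub (p A) A B)) (var A) ≫ q (q (p A) A) B
  hom_p := by
    rw [Category.assoc, q_p, ← Category.assoc, app_p]
    exact pair_q _ _ _ _ _

/-- The `η`-rule for functions: `λ x. k x = k`. -/
class PiEta (C : Type u) [Category.{v} C] [ContextStructure.{w} C] [PiTypes C] : Prop where
  eta {Γ : C} {A : Ty Γ} {B : Ty (ext A)} (k : Tm (Pi A B)) : lam (ev k) = k

/-- Function extensionality: from `h : Π (x : A), Id (k x) (l x)` a term of `Id k l`. -/
class Funext (C : Type u) [Category.{v} C] [ContextStructure.{w} C] [PiTypes C] [IdTypes C] where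
  funext {Γ : C} {A : Ty Γ} {B : Ty (ext A)} (k l : Tm (Pi A B))
    (h : Tm (Pi A (IdTy (ev k).hom (ev l).hom ((ev k).hom_p.trans (ev l).hom_p.symm)))) :
    Tm (IdTy k.hom l.hom (k.hom_p.trans l.hom_p.symm))
  funext_sub {Δ Γ : C} (σ : Δ ⟶ Γ) {A : Ty Γ} {B : Ty (ext A)} (k l : Tm (Pi A B))
    (h : Tm (Pi A (IdTy (ev k).hom (ev l).hom ((ev k).hom_p.trans (ev l).hom_p.symm))))
    (k' l' : Tm (Pi (sub A σ) (sub B (q σ A))))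
    (h' : Tm (Pi (sub A σ)
      (IdTy (ev k').hom (ev l').hom ((ev k').hom_p.trans (ev l').hom_p.symm)))) :
    IsSubst σ k k' → IsSubst σ l l' → IsSubst σ h h' →
      IsSubst σ (funext k l h) (funext k' l' h')

/-- Formation and introduction rules for a closed type `N` of natural numbers. As `N` is closed, a
natural number in context `Γ` is a map `Γ ⟶ 1.N`. -/
class NatIntro (C : Type u) [Category.{v} C] [ContextStructure.{w} C] where
  N : Ty (one : C)
  zero : (one : C) ⟶ ext N
  succ : ext N ⟶ ext N

section Nat

variable {C : Type u} [Category.{v} C] [ContextStructure.{w} C] [NatIntro C]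

/-- The type of natural numbers in context `Γ`. -/
def NatTy (Γ : C) : Ty Γ := sub NatIntro.N (toOne Γ)

/-- `Γ ⊢ 0`. -/
def zeroIn (Γ : C) : Γ ⟶ ext (NatTy Γ) :=
  pair _ _ (toOne Γ ≫ NatIntro.zero) (𝟙 Γ) (toOne_ext _ _)

/-- `Γ, n : N ⊢ succ n`. -/
def succIn (Γ : C) : ext (NatTy Γ) ⟶ ext (NatTy Γ) :=
  pair _ _ (q _ _ ≫ NatIntro.succ) (p _) (toOne_ext _ _)

/-- The canonical map `Δ.N ⟶ Γ.N` over `σ`. -/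
def natMap {Δ Γ : C} (σ : Δ ⟶ Γ) : ext (NatTy Δ) ⟶ ext (NatTy Γ) :=
  pair _ _ (q _ _) (p _ ≫ σ) (toOne_ext _ _)

end Nat

/-- Natural numbers: dependent elimination (from `z : D(0)` and `n : N, d : D(n) ⊢ s : D(succ n)`)
and computation. -/
class NatType (C : Type u) [Category.{v} C] [ContextStructure.{w} C] extends NatIntro C where
  natRec {Γ : C} (D : Ty (ext (NatTy Γ))) (z : Γ ⟶ ext D) (hz : z ≫ p D = zeroIn Γ)
    (s : ext D ⟶ ext D) (hs : s ≫ p D = p D ≫ succIn Γ) : Tm D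
  zero_natRec {Γ : C} (D : Ty (ext (NatTy Γ))) (z : Γ ⟶ ext D) (hz : z ≫ p D = zeroIn Γ)
    (s : ext D ⟶ ext D) (hs : s ≫ p D = p D ≫ succIn Γ) :
    zeroIn Γ ≫ (natRec D z hz s hs).hom = z
  succ_natRec {Γ : C} (D : Ty (ext (NatTy Γ))) (z : Γ ⟶ ext D) (hz : z ≫ p D = zeroIn Γ)
    (s : ext D ⟶ ext D) (hs : s ≫ p D = p D ≫ succIn Γ) :
    succIn Γ ≫ (natRec D z hz s hs).hom = (natRec D z hz s hs).hom ≫ s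
  natRec_sub {Δ Γ : C} (σ : Δ ⟶ Γ) (D : Ty (ext (NatTy Γ))) (z : Γ ⟶ ext D)
    (hz : z ≫ p D = zeroIn Γ) (s : ext D ⟶ ext D) (hs : s ≫ p D = p D ≫ succIn Γ)
    (z' : Δ ⟶ ext (sub D (natMap σ))) (hz' : z' ≫ p _ = zeroIn Δ)
    (s' : ext (sub D (natMap σ)) ⟶ ext (sub D (natMap σ))) (hs' : s' ≫ p _ = p _ ≫ succIn Δ) :
    z' ≫ q _ D = σ ≫ z → s' ≫ q _ D = q _ D ≫ s →
      (natRec _ z' hz' s' hs').hom ≫ q _ D = natMap σ ≫ (natRec D z hz s hs).hom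

/-- A (closed) universe `U`, with its type `El` of elements over `1.U`. An element of `U` in context
`Γ` is a map `a : Γ ⟶ 1.U`, and names the type `sub El a`. The universe contains the type of natural
numbers and is closed under dependent products, dependent sums and identity types. -/
class UniverseType (C : Type u) [Category.{v} C] [ContextStructure.{w} C]
    [PiTypes C] [SigmaTypes C] [IdTypes C] [NatType C] where
  U : Ty (one : C)
  El : Ty (ext U)
  natCode : (one : C) ⟶ ext U
  El_natCode : sub El natCode = NatIntro.N
  piCode {Γ : C} (a : Γ ⟶ ext U) (b : ext (sub El a) ⟶ ext U) : Γ ⟶ ext U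
  El_piCode {Γ : C} (a : Γ ⟶ ext U) (b : ext (sub El a) ⟶ ext U) :
    sub El (piCode a b) = Pi (sub El a) (sub El b)
  piCode_sub {Δ Γ : C} (σ : Δ ⟶ Γ) (a : Γ ⟶ ext U) (b : ext (sub El a) ⟶ ext U) :
    σ ≫ piCode a b = piCode (σ ≫ a) (qOf σ (sub El a) _ (sub_comp σ a El).symm ≫ b)
  sigCode {Γ : C} (a : Γ ⟶ ext U) (b : ext (sub El a) ⟶ ext U) : Γ ⟶ ext U
  El_sigCode {Γ : C} (a : Γ ⟶ ext U) (b : ext (sub El a) ⟶ ext U) :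
    sub El (sigCode a b) = Sig (sub El a) (sub El b)
  sigCode_sub {Δ Γ : C} (σ : Δ ⟶ Γ) (a : Γ ⟶ ext U) (b : ext (sub El a) ⟶ ext U) :
    σ ≫ sigCode a b = sigCode (σ ≫ a) (qOf σ (sub El a) _ (sub_comp σ a El).symm ≫ b)
  idCode {Γ : C} (a : Γ ⟶ ext U) (x y : Tm (sub El a)) : Γ ⟶ ext U
  El_idCode {Γ : C} (a : Γ ⟶ ext U) (x y : Tm (sub El a)) :
    sub El (idCode a x y) = IdTy x.hom y.hom (x.hom_p.trans y.hom_p.symm)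
  idCode_sub {Δ Γ : C} (σ : Δ ⟶ Γ) (a : Γ ⟶ ext U) (x y : Tm (sub El a))
    (x' y' : Tm (sub El (σ ≫ a))) :
    IsSubst σ x x' → IsSubst σ y y' → σ ≫ idCode a x y = idCode (σ ≫ a) x' y'

/-- A categorical model of Martin-Löf type theory with `Π`, `Σ`, `Id`, function extensionality, the
`η`-rule for functions, a type of natural numbers and a universe. -/
class CategoricalModel (C : Type u) [Category.{v} C] extends ContextualCategory.{w} C,
  PiTypes C, SigmaTypes C, IdTypes C, PiEta C, Funext C, NatType C, UniverseType C

/-! ## Equivalences -/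

section Equivalences

variable {C : Type u} [Category.{v} C] [ContextStructure.{w} C]
  [SigmaTypes C]

/-- First projection out of a dependent sum: `z : Σ A B ⊢ fst z : A`. -/
def fst {Γ : C} (A : Ty Γ) (B : Ty (ext A)) : ext (Sig A B) ⟶ ext A :=
  (split (sub A (p (Sig A B))) (pair _ _ (p B) (tuple A B) (tuple_p A B).symm) (pair_p _ _ _ _ _)).hom ≫
    q (p (Sig A B)) A

theorem tuple_fst {Γ : C} (A : Ty Γ) (B : Ty (ext A)) : tuple A B ≫ fst A B = p B := by
  rw [fst, ← Category.assoc, tuple_split, pair_q]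

/-- Both projections out of a dependent sum: the map `Γ.(Σ A B) ⟶ Γ.A.B`, `z ↦ (fst z, snd z)`. -/
def untuple {Γ : C} (A : Ty Γ) (B : Ty (ext A)) : ext (Sig A B) ⟶ ext B :=
  (split (sub B (fst A B))
    (pair _ _ (𝟙 _) (tuple A B) (by rw [tuple_fst, Category.id_comp])) (pair_p _ _ _ _ _)).hom ≫
    q (fst A B) B

theorem tuple_untuple {Γ : C} (A : Ty Γ) (B : Ty (ext A)) : tuple A B ≫ untuple A B = 𝟙 _ := by
  rw [untuple, ← Category.assoc, tuple_split, pair_q]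

variable [PiTypes C] [IdTypes C]

/-- `isContr A := Σ (x₀ : A), Π (x : A), Id x x₀`. -/
def isContr {Γ : C} (A : Ty Γ) : Ty Γ :=
  Sig A (Pi (sub A (p A)) (IdTy (q (p A) A) (p (sub A (p A))) (q_p _ _)))

/-- For a map `f : A ⟶ B` of closed types, the type `y : B ⊢ hfib f y := Σ (x : A), Id (f x) y`. -/
def hfib {A B : Ty (one : C)} (f : ext A ⟶ ext B) : Ty (ext B) :=
  Sig (sub A (toOne (ext B)))
    (IdTy (q (toOne (ext B)) A ≫ f) (p (sub A (toOne (ext B)))) (toOne_ext _ _))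

/-- `isEquiv f := Π (y : B), isContr (hfib f y)`, a closed type. -/
def isEquiv {A B : Ty (one : C)} (f : ext A ⟶ ext B) : Ty (one : C) :=
  Pi B (isContr (hfib f))

variable [NatIntro C]

variable (C) in
/-- The unit type, defined as `Σ (n : N), Id n 0`. -/
def UnitTy : Ty (one : C) :=
  Sig NatIntro.N (IdTy (𝟙 _) (p NatIntro.N ≫ NatIntro.zero) (toOne_ext _ _))

variable (C) in
/-- The element `(0, refl 0)` of the unit type. -/
def star : (one : C) ⟶ ext (UnitTy C) :=
  pair _ _ (NatIntro.zero ≫ refl NatIntro.N) NatIntro.zero (by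
    have h0 : NatIntro.zero ≫ p (NatIntro.N : Ty (one : C)) = 𝟙 _ := toOne_ext _ _
    rw [Category.assoc, refl_p]
    apply (isPullback _ _).hom_ext
    · have e₁ := pair_q (p (NatIntro.N : Ty (one : C))) NatIntro.N (𝟙 _) (𝟙 _) rfl
      have e₂ := pair_q (p (NatIntro.N : Ty (one : C))) NatIntro.N (p NatIntro.N ≫ NatIntro.zero)
        (𝟙 _) (toOne_ext _ _)
      simp only [pair₂, Category.assoc]
      rw [e₁, e₂, ← Category.assoc, h0, Category.comp_id, Category.id_comp]
    · simp only [pair₂, Category.assoc]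
      rw [pair_p, pair_p]) ≫
    tuple _ _

/-- A closed type `ty` together with maps `Γ ⟶ ty ⟶ Γ` that compose to the identity. -/
structure Packing (Γ : C) where
  ty : Ty (one : C)
  pack : Γ ⟶ ext ty
  unpack : ext ty ⟶ Γ
  pack_unpack : pack ≫ unpack = 𝟙 Γ

/-- The iterated `Σ`-type of a context `[x₁ : A₁, …, xₙ : Aₙ]`, with the tupling map from the
context and the map back given by the projections. For `n = 0` it is the unit type, for `n = 1` it
is the type `A₁` itself, and for `n ≥ 2` it is `Σ (z : T), Aₙ(z)` with `T` the iterated `Σ`-type of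
`[x₁ : A₁, …, xₙ₋₁ : Aₙ₋₁]`. -/
def Tower.packing : {Γ : C} → Tower Γ → Packing Γ
  | _, .nil => ⟨UnitTy C, star C, toOne _, toOne_ext _ _⟩
  | _, .snoc .nil A => ⟨A, 𝟙 _, 𝟙 _, Category.id_comp _⟩
  | _, .snoc (.snoc t A) B =>
    let P := (Tower.snoc t A).packing
    { ty := Sig P.ty (sub B P.unpack)
      pack := pair P.unpack B (𝟙 _) (p B ≫ P.pack)
        (by rw [Category.assoc, P.pack_unpack, Category.id_comp, Category.comp_id]) ≫ tuple _ _
      unpack := untuple _ _ ≫ q P.unpack B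
      pack_unpack := by
        rw [Category.assoc, ← Category.assoc (tuple _ _), tuple_untuple]
        exact (congrArg _ (Category.id_comp _)).trans (pair_q _ _ _ _ _) }

end Equivalences

/-! ## The two classes of maps -/

section Classes

variable (C : Type u) [Category.{v} C]

/-- The dependent projections `Γ.A ⟶ Γ`. -/
inductive dependentProjections [ContextStructure.{w} C] : MorphismProperty C
  | of {Γ : C} (A : Ty Γ) : dependentProjections (p A)

/-- Fibrations: the maps isomorphic (in the arrow category) to a finite, possibly empty, composite
of dependent projections. -/
def fibrations [ContextStructure.{w} C] : MorphismProperty C :=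
  (dependentProjections C).multiplicativeClosure.isoClosure

/-- Weak equivalences: the maps `f : Γ ⟶ Δ` such that "`f` is an equivalence" holds in `C`, where
the contexts `Γ` and `Δ` are regarded as single types by taking iterated `Σ`-types. When `Γ` and `Δ`
are (contexts consisting of) single types, this says that the closed type `isEquiv f` has a term. -/
def weakEquivalences [CategoricalModel.{w} C] : MorphismProperty C := fun Γ Δ f =>
  Nonempty (Tm (isEquiv
    ((ContextualCategory.tower Γ).packing.unpack ≫ f ≫ (ContextualCategory.tower Δ).packing.pack)))

end Classes

/-- A category with classes `W` of weak equivalences and `F` of fibrations is a fibration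
category. -/
structure IsFibrationCategory {C : Type u} [Category.{v} C] (W F : MorphismProperty C) : Prop where
  two_out_of_six {X₀ X₁ X₂ X₃ : C} (f : X₀ ⟶ X₁) (g : X₁ ⟶ X₂) (h : X₂ ⟶ X₃) :
    W (f ≫ g) → W (g ≫ h) → W f ∧ W g ∧ W h ∧ W (f ≫ g ≫ h)
  fibration_comp {X Y Z : C} (f : X ⟶ Y) (g : Y ⟶ Z) : F f → F g → F (f ≫ g)
  acyclicFibration_of_isIso {X Y : C} (f : X ⟶ Y) : IsIso f → W f ∧ F f
  hasTerminal : HasTerminal C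
  hasPullback {X Y Z : C} (f : X ⟶ Z) (g : Y ⟶ Z) : F g → HasPullback f g
  fibration_pullback {P X Y Z : C} {fst : P ⟶ X} {snd : P ⟶ Y} {f : X ⟶ Z} {g : Y ⟶ Z} :
    IsPullback fst snd f g → F g → F fst
  acyclicFibration_pullback {P X Y Z : C} {fst : P ⟶ X} {snd : P ⟶ Y} {f : X ⟶ Z} {g : Y ⟶ Z} :
    IsPullback fst snd f g → W g ∧ F g → W fst ∧ F fst
  pathObject (X : C) : ∃ (_ : HasBinaryProduct X X) (P : C) (r : X ⟶ P) (π : P ⟶ X ⨯ X),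
    W r ∧ F π ∧ r ≫ π = diag X
  fibrant {X T : C} (hT : IsTerminal T) : F (hT.from X)

end ModelsOfTypeTheory

end

/-!
The proof identifies the weak equivalences with the maps that become invertible in a homotopy
category, so that 2-out-of-6 becomes a property of isomorphisms.

*Anodyne maps* are the maps with the left lifting property against dependent projections. By the
elimination rules, `refl` and `tuple` are anodyne, and by means of `Π`-types anodyne maps are stable
under pullback along dependent projections (`anodyne_q`). The *homotopy category* is the quotient of
`C` that identifies two maps if they agree after precomposition with an anodyne map. Anodyne
maps become invertible in it (`homotopyEquivalences_of_anodyne`), and terms of types can be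
transported along equalities of maps in it (`lifts_iff_of_map_eq`).

Transport implies that the projection `Γ.B ⟶ Γ` is a homotopy equivalence if and only if `B` is
contractible in context `Γ` (`isContractible_iff`). Contractibility is stable under substitution,
and `Σ`-types turn a composite of dependent projections into a single one, up to an anodyne map;
hence acyclic fibrations are stable under pullback (`homotopyEquivalences_of_isPullback`).

The endpoint projections of an identity type are acyclic fibrations, as `refl` is an anodyne section
of them. Pulling them back along a map `f : X ⟶ T` to a closed type shows that the mapping path
space of `f` is equivalent to `X`. If `X` is a closed type too, then the projection from the mapping
path space to `T` is, up to an anodyne map, the projection from the type `hfib f`, so that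
`isEquiv f` has a term if and only if `f` is a homotopy equivalence (`nonempty_tm_isEquiv_iff`). The
tupling map from a context to its iterated `Σ`-type is a homotopy equivalence too, which extends the
comparison to all contexts (`weakEquivalences_eq`). The pullback along this tupling map of its own
mapping path space is a path object (`exists_pathObject`).
-/

namespace ModelsOfTypeTheory

open ContextStructure PiTypes SigmaTypes IdTypes

/-! ### Substitution in types and terms -/

section Substitution

variable {C : Type u} [Category.{v} C] [ContextStructure.{w} C]

/-- `A₁` is the type `A[σ]` and `α : Δ.A₁ ⟶ Γ.A` is the canonical map over `σ`. Recording this as a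
predicate, instead of rewriting `A₁` along an equality of types, keeps `eqToHom` out of statements
about iterated substitutions. -/
def IsTySubst {Δ Γ : C} (σ : Δ ⟶ Γ) (A : Ty Γ) (A₁ : Ty Δ) (α : ext A₁ ⟶ ext A) : Prop :=
  ∃ e : sub A σ = A₁, α = qOf σ A A₁ e

theorem qOf_rfl {Δ Γ : C} (σ : Δ ⟶ Γ) (A : Ty Γ) : qOf σ A _ rfl = q σ A := by
  simp [qOf]

theorem isTySubst_sub {Δ Γ : C} (σ : Δ ⟶ Γ) (A : Ty Γ) : IsTySubst σ A (sub A σ) (q σ A) :=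
  ⟨rfl, (qOf_rfl σ A).symm⟩

theorem exists_isTySubst {Δ Γ : C} {σ : Δ ⟶ Γ} {A : Ty Γ} {A₁ : Ty Δ} (e : sub A σ = A₁) :
    ∃ α, IsTySubst σ A A₁ α :=
  ⟨_, e, rfl⟩

namespace IsTySubst

variable {Θ Δ Γ : C} {τ : Θ ⟶ Δ} {σ : Δ ⟶ Γ} {A : Ty Γ} {A₁ : Ty Δ} {A₂ : Ty Θ}
  {α α' : ext A₁ ⟶ ext A} {β : ext A₂ ⟶ ext A₁}

theorem isPullback (h : IsTySubst σ A A₁ α) : IsPullback α (p A₁) (p A) σ := by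
  obtain ⟨rfl, rfl⟩ := h
  rw [qOf_rfl]
  exact ContextStructure.isPullback σ A

theorem unique (h : IsTySubst σ A A₁ α) (h' : IsTySubst σ A A₁ α') : α = α' := by
  obtain ⟨_, rfl⟩ := h
  obtain ⟨_, rfl⟩ := h'
  rfl

theorem comp (hτ : IsTySubst τ A₁ A₂ β) (h : IsTySubst σ A A₁ α) :
    IsTySubst (τ ≫ σ) A A₂ (β ≫ α) := by
  obtain ⟨rfl, rfl⟩ := h
  obtain ⟨rfl, rfl⟩ := hτ
  exact ⟨sub_comp _ _ _, by simp [qOf, q_comp]⟩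

theorem isSubst (h : IsTySubst σ A A₁ α) {s : Tm A} {s₁ : Tm A₁} (hs : s₁.hom ≫ α = σ ≫ s.hom) :
    IsSubst σ s s₁ := by
  obtain ⟨e, rfl⟩ := h
  exact ⟨e, hs⟩

theorem hom_comp (h : IsTySubst σ A A₁ α) {s : Tm A} {s₁ : Tm A₁} (hs : IsSubst σ s s₁) :
    s₁.hom ≫ α = σ ≫ s.hom := by
  obtain ⟨_, rfl⟩ := h
  exact hs.2

end IsTySubst

theorem Tm.ext_hom {Γ : C} {A : Ty Γ} {s t : Tm A} (h : s.hom = t.hom) : s = t := by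
  cases s; cases t; cases h; rfl

theorem IsSubst.unique {Δ Γ : C} {σ : Δ ⟶ Γ} {A : Ty Γ} {A₁ : Ty Δ} {s : Tm A} {t t' : Tm A₁}
    (h : IsSubst σ s t) (h' : IsSubst σ s t') : t = t' := by
  obtain ⟨α, hα⟩ := exists_isTySubst h.1
  refine Tm.ext_hom (hα.isPullback.hom_ext ?_ ?_)
  · rw [hα.hom_comp h, hα.hom_comp h']
  · rw [t.hom_p, t'.hom_p]

theorem isSubst_cast_sub {Δ Γ : C} (σ : Δ ⟶ Γ) {A : Ty Γ} {A₁ : Ty Δ} (s : Tm A)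
    (e : sub A σ = A₁) : IsSubst σ s ((s.sub σ).cast e) := by
  subst e
  exact ⟨rfl, by rw [qOf_rfl]; exact pair_q _ _ _ _ _⟩

/-- The map `a : X ⟶ Γ` has a lift to `Γ.B`; equivalently, `B[a]` has a term in context `X`. -/
def Lifts {X Γ : C} (a : X ⟶ Γ) (B : Ty Γ) : Prop :=
  ∃ e : X ⟶ ext B, e ≫ p B = a

theorem lifts_sub_iff {X Δ Γ : C} (a : X ⟶ Δ) (σ : Δ ⟶ Γ) (B : Ty Γ) :
    Lifts a (sub B σ) ↔ Lifts (a ≫ σ) B := by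
  constructor
  · rintro ⟨e, rfl⟩
    exact ⟨e ≫ q σ B, by rw [Category.assoc, q_p, Category.assoc]⟩
  · rintro ⟨e, he⟩
    exact ⟨pair σ B e a he, pair_p _ _ _ _ _⟩

theorem Lifts.precomp {X Y Γ : C} {a : X ⟶ Γ} {B : Ty Γ} (h : Lifts a B) (f : Y ⟶ X) :
    Lifts (f ≫ a) B := by
  obtain ⟨e, rfl⟩ := h
  exact ⟨f ≫ e, Category.assoc _ _ _⟩

theorem lifts_id_iff {Γ : C} (B : Ty Γ) : Lifts (𝟙 Γ) B ↔ Nonempty (Tm B) :=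
  ⟨fun ⟨e, he⟩ => ⟨⟨e, he⟩⟩, fun ⟨s⟩ => ⟨s.hom, s.hom_p⟩⟩

theorem var_hom_q {Γ : C} (A : Ty Γ) : (var A).hom ≫ q (p A) A = 𝟙 _ := pair_q _ _ _ _ _

end Substitution

/-! ### Evaluation of dependent functions -/

section Products

variable {C : Type u} [Category.{v} C] [ContextStructure.{w} C] [PiTypes C]
  {Δ Γ : C} {σ : Δ ⟶ Γ} {A : Ty Γ} {B : Ty (ext A)} {A₁ : Ty Δ} {B₁ : Ty (ext A₁)}
  {α : ext A₁ ⟶ ext A} {β : ext B₁ ⟶ ext B}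

theorem pi_sub_eq (hα : IsTySubst σ A A₁ α) (hβ : IsTySubst α B B₁ β) :
    sub (Pi A B) σ = Pi A₁ B₁ := by
  obtain ⟨rfl, rfl⟩ := hα
  obtain ⟨rfl, rfl⟩ := hβ
  rw [Pi_sub, qOf_rfl]

theorem app_comp_eq (hα : IsTySubst σ A A₁ α) (hβ : IsTySubst α B B₁ β) {k : Tm (Pi A B)}
    {k₁ : Tm (Pi A₁ B₁)} {a : Tm A} {a₁ : Tm A₁} (hk : IsSubst σ k k₁) (ha : IsSubst σ a a₁) :
    app k₁ a₁ ≫ β = σ ≫ app k a := by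
  obtain ⟨rfl, h⟩ := hα
  rw [qOf_rfl] at h
  subst h
  obtain ⟨rfl, h⟩ := hβ
  rw [qOf_rfl] at h
  subst h
  exact app_sub σ k a k₁ a₁ hk ha

theorem ev_lam {Γ : C} {A : Ty Γ} {B : Ty (ext A)} (b : Tm B) : ev (lam b) = b := by
  apply Tm.ext_hom
  have h : ((lam b).sub (p A)).cast (Pi_sub (p A) A B) = lam (b.sub (q (p A) A)) :=
    (isSubst_cast_sub (p A) (lam b) (Pi_sub (p A) A B)).unique
      (lam_sub _ _ _ (isSubst_cast_sub _ b rfl))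
  have h' : (b.sub (q (p A) A)).hom ≫ q (q (p A) A) B = q (p A) A ≫ b.hom := pair_q _ _ _ _ _
  simp only [ev]
  rw [h, beta, Category.assoc, h', ← Category.assoc, var_hom_q, Category.id_comp]

/-- Evaluation `x : A ⊢ k x` commutes with substitution. -/
theorem ev_isSubst (σ : Δ ⟶ Γ) {k : Tm (Pi A B)} {k₁ : Tm (Pi (sub A σ) (sub B (q σ A)))}
    (hk : IsSubst σ k k₁) : IsSubst (q σ A) (ev k) (ev k₁) := by
  -- `hα`, `hβ`: substitution along `q σ A` of the weakenings of `A` and `B` to `Γ.A` gives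
  -- the weakenings of `A[σ]` and `B[σ]` to `Δ.A[σ]`.
  have eA : sub (sub A (p A)) (q σ A) = sub (sub A σ) (p (sub A σ)) := by
    rw [← sub_comp, ← sub_comp, q_p]
  obtain ⟨α, hα⟩ := exists_isTySubst eA
  have hαq : α ≫ q (p A) A = q (p (sub A σ)) (sub A σ) ≫ q σ A := by
    refine (hα.comp (isTySubst_sub _ _)).unique ?_
    rw [q_p]
    exact (isTySubst_sub _ _).comp (isTySubst_sub _ _)
  have eB : sub (sub B (q (p A) A)) α = sub (sub B (q σ A)) (q (p (sub A σ)) (sub A σ)) :=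
    (sub_comp _ _ _).symm.trans ((congrArg _ hαq).trans (sub_comp _ _ _))
  obtain ⟨β, hβ⟩ := exists_isTySubst eB
  have hβq : β ≫ q (q (p A) A) B = q (q (p (sub A σ)) (sub A σ)) (sub B (q σ A)) ≫ q (q σ A) B := by
    refine (hβ.comp (isTySubst_sub _ _)).unique ?_
    rw [hαq]
    exact (isTySubst_sub _ _).comp (isTySubst_sub _ _)
  have hvar : IsSubst (q σ A) (var A) (var (sub A σ)) := by
    refine hα.isSubst ((isPullback (p A) A).hom_ext ?_ ?_)
    · rw [Category.assoc, hαq, Category.assoc, ← Category.assoc, var_hom_q, var_hom_q,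
        Category.id_comp, Category.comp_id]
    · rw [Category.assoc, hα.isPullback.w, ← Category.assoc, (var _).hom_p, Category.assoc,
        (var A).hom_p, Category.id_comp, Category.comp_id]
  obtain ⟨π, hπ⟩ := exists_isTySubst (pi_sub_eq hα hβ)
  obtain ⟨π₀, hπ₀⟩ := exists_isTySubst (Pi_sub (p A) A B)
  obtain ⟨π₁, hπ₁⟩ := exists_isTySubst (Pi_sub σ A B)
  obtain ⟨π₂, hπ₂⟩ := exists_isTySubst (Pi_sub (p (sub A σ)) (sub A σ) (sub B (q σ A)))
  have hk' : IsSubst (q σ A) ((k.sub (p A)).cast (Pi_sub (p A) A B))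
      ((k₁.sub (p (sub A σ))).cast (Pi_sub (p (sub A σ)) (sub A σ) (sub B (q σ A)))) := by
    refine hπ.isSubst (hπ₀.isPullback.hom_ext ?_ ?_)
    · have h : π ≫ π₀ = π₂ ≫ π₁ := by
        refine (hπ.comp hπ₀).unique ?_
        rw [q_p]
        exact hπ₂.comp hπ₁
      rw [Category.assoc, h, ← Category.assoc, hπ₂.hom_comp (isSubst_cast_sub _ _ _),
        Category.assoc, hπ₁.hom_comp hk, Category.assoc, hπ₀.hom_comp (isSubst_cast_sub _ _ _),
        ← Category.assoc, ← Category.assoc, q_p]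
    · rw [Category.assoc, hπ.isPullback.w, ← Category.assoc, Tm.hom_p, Category.assoc, Tm.hom_p,
        Category.id_comp, Category.comp_id]
  refine (isTySubst_sub _ _).isSubst ?_
  simp only [ev]
  rw [Category.assoc, ← hβq, ← Category.assoc, app_comp_eq hα hβ hk' hvar, Category.assoc]

end Products

/-! ### Anodyne maps and the Frobenius property -/

section Anodyne

variable (C : Type u) [Category.{v} C] [ContextStructure.{w} C]

/-- Anodyne maps: the maps with the left lifting property against all dependent projections. -/
abbrev anodyne : MorphismProperty C := (dependentProjections C).llp

variable {C}

/-- As dependent projections are stable under pullback, it is enough to lift against dependent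
projections to the target. -/
theorem anodyne_iff {X Y : C} (i : X ⟶ Y) :
    anodyne C i ↔ ∀ (D : Ty Y) (d : X ⟶ ext D), d ≫ p D = i → ∃ s : Tm D, i ≫ s.hom = d := by
  constructor
  · intro h D d hd
    have := h _ (dependentProjections.of D)
    have sq : CommSq d i (p D) (𝟙 Y) := ⟨by rw [hd, Category.comp_id]⟩
    exact ⟨⟨sq.lift, sq.fac_right⟩, sq.fac_left⟩
  · rintro h _ _ _ ⟨D⟩
    refine ⟨fun {f g} sq => ?_⟩
    obtain ⟨s, hs⟩ := h (sub D g) (pair g D f i sq.w) (pair_p _ _ _ _ _)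
    refine ⟨⟨⟨s.hom ≫ q g D, ?_, ?_⟩⟩⟩
    · rw [← Category.assoc, hs, pair_q]
    · rw [Category.assoc, q_p, ← Category.assoc, s.hom_p, Category.id_comp]

theorem anodyne_tuple [SigmaTypes C] {Γ : C} (A : Ty Γ) (B : Ty (ext A)) :
    anodyne C (tuple A B) :=
  (anodyne_iff _).2 fun D d hd => ⟨split D d hd, tuple_split D d hd⟩

theorem anodyne_refl [IdTypes C] {Γ : C} (A : Ty Γ) : anodyne C (refl A) :=
  (anodyne_iff _).2 fun D d hd => ⟨J D d hd, refl_J D d hd⟩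

/-- The Frobenius property: dependent products imply that anodyne maps are stable under pullback
along dependent projections. A lifting problem for the pulled back map against a type `D` over `Y.B`
is transposed to one for `i` against `Π B D`. -/
theorem anodyne_q [PiTypes C] {X Y : C} {i : X ⟶ Y} (hi : anodyne C i) (B : Ty Y) :
    anodyne C (q i B) := by
  rw [anodyne_iff] at hi ⊢
  intro D d hd
  let b : Tm (sub D (q i B)) := ⟨pair _ D d (𝟙 _) (by rw [hd, Category.id_comp]), pair_p _ _ _ _ _⟩
  obtain ⟨π, hπ⟩ := exists_isTySubst (Pi_sub i B D)
  obtain ⟨k, hk⟩ := hi (Pi B D) ((lam b).hom ≫ π)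
    (by rw [Category.assoc, hπ.isPullback.w, ← Category.assoc, Tm.hom_p, Category.id_comp])
  have h := (isTySubst_sub _ _).hom_comp (ev_isSubst i (hπ.isSubst hk.symm))
  rw [ev_lam] at h
  exact ⟨ev k, h.symm.trans (pair_q _ _ _ _ _)⟩

theorem anodyne_of_isPullback [PiTypes C] {X Y P : C} {i : X ⟶ Y} (hi : anodyne C i) {B : Ty Y}
    {j : P ⟶ ext B} {g : P ⟶ X} (h : IsPullback j g (p B) i) : anodyne C j := by
  rw [← h.isoIsPullback_hom_fst _ _ (isPullback i B)]
  exact (anodyne C).comp_mem _ _ (MorphismProperty.llp_of_isIso _ _) (anodyne_q hi B)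

end Anodyne

/-! ### Fibrations -/

section Fibrations

variable {C : Type u} [Category.{v} C] [ContextStructure.{w} C]

/-- Composites of dependent projections have canonical pullbacks, which are again composites of
dependent projections. -/
theorem exists_isPullback_of_multiplicativeClosure {X Y Z : C} (f : X ⟶ Z) {g : Y ⟶ Z}
    (hg : (dependentProjections C).multiplicativeClosure g) :
    ∃ (P : C) (p₁ : P ⟶ X) (p₂ : P ⟶ Y),
      IsPullback p₁ p₂ f g ∧ (dependentProjections C).multiplicativeClosure p₁ := by
  induction hg generalizing X with
  | of g hg =>
    obtain ⟨A⟩ := hg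
    exact ⟨_, _, _, (isPullback f A).flip, .of _ (.of _)⟩
  | id Y => exact ⟨X, 𝟙 X, f, .of_horiz_isIso ⟨by simp⟩, .id _⟩
  | comp_of g₁ g₂ _ hg₂ ih =>
    obtain ⟨A⟩ := hg₂
    obtain ⟨P, p₁, p₂, h, hp⟩ := ih (q f A)
    exact ⟨P, p₁ ≫ p (sub A f), p₂, (h.flip.paste_vert (isPullback f A)).flip,
      .comp_of _ _ hp (.of _)⟩

/-- In the definition of fibrations the isomorphism of targets can be dispensed with, by pulling
back along it. -/
theorem fibrations_iff {X Y : C} (f : X ⟶ Y) :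
    fibrations C f ↔ ∃ (X' : C) (e : X ≅ X') (f' : X' ⟶ Y),
      (dependentProjections C).multiplicativeClosure f' ∧ e.hom ≫ f' = f := by
  constructor
  · rintro ⟨A, B, g, hg, ⟨e⟩⟩
    obtain ⟨P, p₁, p₂, h, hp⟩ := exists_isPullback_of_multiplicativeClosure
      e.inv.right hg
    have h' : IsPullback f e.inv.left e.inv.right g := .of_vert_isIso ⟨(Arrow.w e.inv).symm⟩
    exact ⟨P, h'.isoIsPullback _ _ h, p₁, hp, h'.isoIsPullback_hom_fst _ _ h⟩
  · rintro ⟨X', e, f', hf', rfl⟩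
    exact ⟨_, _, f', hf', ⟨Arrow.isoMk e.symm (Iso.refl _)⟩⟩

instance : (fibrations C).RespectsIso :=
  inferInstanceAs (MorphismProperty.isoClosure _).RespectsIso

theorem fibrations_of_multiplicativeClosure {X Y : C} {f : X ⟶ Y}
    (hf : (dependentProjections C).multiplicativeClosure f) : fibrations C f :=
  MorphismProperty.le_isoClosure _ _ hf

theorem fibrations_p {Γ : C} (A : Ty Γ) : fibrations C (p A) :=
  fibrations_of_multiplicativeClosure (.of _ (.of A))

theorem fibrations_of_isIso {X Y : C} (f : X ⟶ Y) [IsIso f] : fibrations C f :=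
  (fibrations_iff f).2 ⟨_, asIso f, 𝟙 _, .id _, Category.comp_id _⟩

theorem exists_isPullback_of_fibrations {X Y Z : C} (f : X ⟶ Z) {g : Y ⟶ Z}
    (hg : fibrations C g) :
    ∃ (P : C) (p₁ : P ⟶ X) (p₂ : P ⟶ Y), IsPullback p₁ p₂ f g ∧ fibrations C p₁ := by
  obtain ⟨Y', e, g', hg', rfl⟩ := (fibrations_iff g).1 hg
  obtain ⟨P, p₁, p₂, h, hp⟩ := exists_isPullback_of_multiplicativeClosure f hg'
  refine ⟨P, p₁, p₂ ≫ e.inv, ?_, fibrations_of_multiplicativeClosure hp⟩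
  exact .of_iso h (Iso.refl _) (Iso.refl _) e.symm (Iso.refl _) (by simp) (by simp) (by simp)
    (by simp)

theorem fibrations_of_isPullback {P X Y Z : C} {p₁ : P ⟶ X} {p₂ : P ⟶ Y} {f : X ⟶ Z} {g : Y ⟶ Z}
    (h : IsPullback p₁ p₂ f g) (hg : fibrations C g) : fibrations C p₁ := by
  obtain ⟨P', p₁', p₂', h', hp⟩ := exists_isPullback_of_fibrations f hg
  rw [← h.isoIsPullback_hom_fst _ _ h']
  exact (MorphismProperty.cancel_left_of_respectsIso _ _ _).2 hp

theorem fibrations_comp {X Y Z : C} {f : X ⟶ Y} {g : Y ⟶ Z} (hf : fibrations C f)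
    (hg : fibrations C g) : fibrations C (f ≫ g) := by
  obtain ⟨Y', e, g', hg', rfl⟩ := (fibrations_iff g).1 hg
  have hf' : fibrations C (f ≫ e.hom) := (MorphismProperty.cancel_right_of_respectsIso _ _ _).2 hf
  obtain ⟨X', e', f', hf', hf'e⟩ := (fibrations_iff _).1 hf'
  exact (fibrations_iff _).2 ⟨X', e', f' ≫ g',
    ((dependentProjections C).multiplicativeClosure).comp_mem _ _ hf' hg', by
      rw [← Category.assoc, hf'e, Category.assoc]⟩

theorem multiplicativeClosure_toOne_of_tower {Γ : C} (t : Tower Γ) :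
    (dependentProjections C).multiplicativeClosure (toOne Γ) := by
  induction t with
  | nil =>
    rw [toOne_ext (toOne one) (𝟙 _)]
    exact .id _
  | snoc t A ih =>
    rw [toOne_ext (toOne _) (p A ≫ toOne _)]
    exact MorphismProperty.comp_mem _ _ _ (.of _ (.of A)) ih

theorem hasLiftingProperty_of_anodyne {X Y E B : C} {i : X ⟶ Y} {g : E ⟶ B}
    (hi : anodyne C i) (hg : (dependentProjections C).multiplicativeClosure g) :
    HasLiftingProperty i g :=
  (MorphismProperty.multiplicativeClosure_le_iff _ (anodyne C).rlp).2
    ((MorphismProperty.le_llp_iff_le_rlp _ _).1 le_rfl) _ hg _ hi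

/-- By means of dependent sums, a composite of dependent projections can be replaced by a single
dependent projection, up to an anodyne map. The empty composite is left as an isomorphism: it need
not admit an anodyne map to a unit type over the target. -/
theorem exists_anodyne_comp_p [SigmaTypes C] {Y Z : C} {g : Y ⟶ Z}
    (hg : (dependentProjections C).multiplicativeClosure g) :
    IsIso g ∨ ∃ (S : Ty Z) (i : Y ⟶ ext S), anodyne C i ∧ i ≫ p S = g := by
  induction hg with
  | of g hg =>
    obtain ⟨A⟩ := hg
    exact .inr ⟨A, 𝟙 _, (anodyne C).id_mem _, Category.id_comp _⟩
  | id Y => exact .inl inferInstance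
  | comp_of g₁ g₂ _ hg₂ ih =>
    obtain ⟨A⟩ := hg₂
    obtain h | ⟨S, i, hi, rfl⟩ := ih
    · exact .inr ⟨A, g₁, MorphismProperty.llp_of_isIso _ _, rfl⟩
    · exact .inr ⟨Sig A S, i ≫ tuple A S, (anodyne C).comp_mem _ _ hi (anodyne_tuple A S), by
        rw [Category.assoc, tuple_p, Category.assoc]⟩

end Fibrations

/-! ### The homotopy category -/

section HomotopyCategory

variable (C : Type u) [Category.{v} C] [ContextStructure.{w} C]

/-- Maps `s t : X ⟶ Y` that agree after precomposition with an anodyne map. For example, the two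
projections from the total space of an identity type agree after precomposition with `refl`. -/
def anodyneRel : HomRel C := fun X _ s t => ∃ (W : C) (i : W ⟶ X), anodyne C i ∧ i ≫ s = i ≫ t

/-- The functor to the homotopy category, the quotient of `C` by the congruence that is generated by
`anodyneRel`. -/
abbrev toHo : C ⥤ CategoryTheory.Quotient (anodyneRel C) :=
  CategoryTheory.Quotient.functor _

/-- Homotopy equivalences: the maps that become invertible in the homotopy category. -/
abbrev homotopyEquivalences : MorphismProperty C :=
  (MorphismProperty.isomorphisms _).inverseImage (toHo C)

variable {C}

theorem homotopyEquivalences_of_isIso {X Y : C} (f : X ⟶ Y) [IsIso f] :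
    homotopyEquivalences C f :=
  inferInstanceAs (IsIso ((toHo C).map f))

theorem homotopyEquivalences_two_out_of_six {X₀ X₁ X₂ X₃ : C} {f : X₀ ⟶ X₁} {g : X₁ ⟶ X₂}
    {h : X₂ ⟶ X₃} (hfg : homotopyEquivalences C (f ≫ g)) (hgh : homotopyEquivalences C (g ≫ h)) :
    homotopyEquivalences C f ∧ homotopyEquivalences C g ∧ homotopyEquivalences C h ∧
      homotopyEquivalences C (f ≫ g ≫ h) := by
  have hg : homotopyEquivalences C g := by
    have h₁ : IsIso ((toHo C).map (f ≫ g)) := hfg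
    have h₂ : IsIso ((toHo C).map (g ≫ h)) := hgh
    rw [Functor.map_comp] at h₁ h₂
    -- `g` is a monomorphism, and it has a right inverse, in the homotopy category
    have := mono_of_mono ((toHo C).map g) ((toHo C).map h)
    have : IsSplitEpi ((toHo C).map g) :=
      ⟨⟨inv ((toHo C).map f ≫ (toHo C).map g) ≫ (toHo C).map f, by simp⟩⟩
    exact isIso_of_mono_of_isSplitEpi _
  have hf := MorphismProperty.of_postcomp _ _ _ hg hfg
  exact ⟨hf, hg, MorphismProperty.of_precomp _ _ _ hg hgh, MorphismProperty.comp_mem _ _ _ hf hgh⟩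

/-- An anodyne map `i` has a retraction `r`, because its source is fibrant, and `r ≫ i` agrees with
`𝟙` after precomposition with `i`. -/
theorem homotopyEquivalences_of_anodyne_of_tower {X Y : C} {i : X ⟶ Y} (hi : anodyne C i)
    (t : Tower X) : homotopyEquivalences C i := by
  have := hasLiftingProperty_of_anodyne hi (multiplicativeClosure_toOne_of_tower t)
  have sq : CommSq (𝟙 X) i (toOne X) (toOne Y) := ⟨toOne_ext _ _⟩
  have h₁ : i ≫ sq.lift = 𝟙 X := sq.fac_left
  refine ⟨(toHo C).map sq.lift, ?_, ?_⟩
  · rw [← Functor.map_comp, h₁, CategoryTheory.Functor.map_id]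
  · rw [← Functor.map_comp, ← CategoryTheory.Functor.map_id]
    exact CategoryTheory.Quotient.sound _ ⟨X, i, hi, by rw [← Category.assoc, h₁]; simp⟩

/-- Transport along a generating homotopy: by the Frobenius property, `V.B[s]` is obtained from
`W.B[i ≫ s]` by an anodyne map, over which the identity of `B[i ≫ s] = B[i ≫ t]` extends to a map
`B[s] ⟶ B[t]`. -/
theorem lifts_of_anodyne [PiTypes C] {V W X Z : C} {i : W ⟶ V} (hi : anodyne C i) {s t : V ⟶ Z}
    (hst : i ≫ s = i ≫ t) (u : X ⟶ V) {B : Ty Z} (h : Lifts (u ≫ s) B) : Lifts (u ≫ t) B := by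
  obtain ⟨e, he⟩ := (lifts_sub_iff u s B).2 h
  have := anodyne_q hi (sub B s) _ (dependentProjections.of B)
  have sq : CommSq (q i (sub B s) ≫ q s B) (q i (sub B s)) (p B) (p (sub B s) ≫ t) := ⟨by
    rw [Category.assoc, q_p, ← Category.assoc, q_p, Category.assoc, hst, ← Category.assoc, ← q_p,
      Category.assoc]⟩
  exact ⟨e ≫ sq.lift, by rw [Category.assoc, sq.fac_right, ← Category.assoc, he]⟩

/-- Transport: if `a` and `b` are homotopic, then a term of `B[a]` gives a term of `B[b]`. -/
theorem lifts_iff_of_map_eq [PiTypes C] {X Z : C} {a b : X ⟶ Z}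
    (h : (toHo C).map a = (toHo C).map b) (B : Ty Z) : Lifts a B ↔ Lifts b B := by
  have h' := (Quotient.functor_homRel_eq_compClosure_eqvGen _ _ _).1 h
  clear h
  induction h' with
  | rel _ _ h =>
    obtain ⟨_, _, f, m₁, m₂, g, _, i, hi, h⟩ := h
    have h' : i ≫ m₁ ≫ g = i ≫ m₂ ≫ g := by rw [← Category.assoc, h, Category.assoc]
    exact ⟨lifts_of_anodyne hi h' f, lifts_of_anodyne hi h'.symm f⟩
  | refl => rfl
  | symm _ _ _ ih => exact ih.symm
  | trans _ _ _ _ _ ih₁ ih₂ => exact ih₁.trans ih₂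

end HomotopyCategory

/-! ### Contractible types -/

section Contractible

variable {C : Type u} [Category.{v} C] [ContextStructure.{w} C]

section

variable {X Γ : C} {A : Ty Γ}

theorem pair₂_p (a b : X ⟶ ext A) (h : a ≫ p A = b ≫ p A) : pair₂ a b h ≫ p _ = a :=
  pair_p _ _ _ _ _

theorem pair₂_q (a b : X ⟶ ext A) (h : a ≫ p A = b ≫ p A) : pair₂ a b h ≫ q (p A) A = b :=
  pair_q _ _ _ _ _

theorem eq_pair₂ {f : X ⟶ ext (sub A (p A))} {a b : X ⟶ ext A} (ha : f ≫ p _ = a)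
    (hb : f ≫ q (p A) A = b) (h : a ≫ p A = b ≫ p A) : f = pair₂ a b h :=
  (isPullback (p A) A).hom_ext (by rw [hb, pair₂_q]) (by rw [ha, pair₂_p])

end

variable [IdTypes C]

theorem refl_p_p {Γ : C} (A : Ty Γ) : refl A ≫ p (IdF A) ≫ p (sub A (p A)) = 𝟙 _ := by
  rw [← Category.assoc, refl_p, pair₂_p]

theorem refl_p_q {Γ : C} (A : Ty Γ) : refl A ≫ p (IdF A) ≫ q (p A) A = 𝟙 _ := by
  rw [← Category.assoc, refl_p, pair₂_q]

theorem lifts_pair₂_self {X Γ : C} {A : Ty Γ} {a b : X ⟶ ext A} (e : a = b)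
    (h : a ≫ p A = b ≫ p A) : Lifts (pair₂ a b h) (IdF A) := by
  subst e
  refine ⟨a ≫ refl A, eq_pair₂ ?_ ?_ _⟩
  · rw [Category.assoc, Category.assoc, refl_p_p, Category.comp_id]
  · rw [Category.assoc, Category.assoc, refl_p_q, Category.comp_id]

/-- The type `B` in context `Γ` is contractible: there are `y : Γ ⊢ s y : B y` and
`y : Γ, x : B y ⊢ Id x (s y)`. -/
def IsContractible {Γ : C} (B : Ty Γ) : Prop :=
  ∃ s : Tm B, Lifts (pair₂ (𝟙 (ext B)) (p B ≫ s.hom)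
    (by rw [Category.assoc, s.hom_p, Category.id_comp, Category.comp_id])) (IdF B)

theorem IsContractible.sub {Δ Γ : C} {B : Ty Γ} (h : IsContractible B) (σ : Δ ⟶ Γ) :
    IsContractible (sub B σ) := by
  obtain ⟨s, hs⟩ := h
  refine ⟨s.sub σ, ?_⟩
  rw [← IdF_sub, lifts_sub_iff]
  convert hs.precomp (q σ B) using 1
  have e₁ : (s.sub σ).hom ≫ q σ B = σ ≫ s.hom := pair_q _ _ _ _ _
  refine (isPullback (p B) B).hom_ext ?_ ?_
  · rw [Category.assoc, Category.assoc, q₂, pair₂_q, pair₂_q, ← Category.assoc, pair₂_q,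
      Category.assoc, e₁, ← Category.assoc, ← q_p, Category.assoc]
  · rw [Category.assoc, Category.assoc, q₂, pair₂_p, pair₂_p, ← Category.assoc, pair₂_p,
      Category.id_comp, Category.comp_id]

theorem IsContractible.homotopyEquivalences_p {Γ : C} {B : Ty Γ} (h : IsContractible B) :
    homotopyEquivalences C (p B) := by
  obtain ⟨s, k, hk⟩ := h
  refine ⟨(toHo C).map s.hom, ?_, ?_⟩
  · have h₁ : k ≫ p (IdF B) ≫ p _ = 𝟙 _ := by rw [← Category.assoc, hk, pair₂_p]
    have h₂ : k ≫ p (IdF B) ≫ q _ _ = p B ≫ s.hom := by rw [← Category.assoc, hk, pair₂_q]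
    rw [← Functor.map_comp, ← CategoryTheory.Functor.map_id, ← h₁, ← h₂, Functor.map_comp,
      Functor.map_comp _ k]
    congr 1
    exact CategoryTheory.Quotient.sound _ ⟨_, refl B, anodyne_refl B, by rw [refl_p_p, refl_p_q]⟩
  · rw [← Functor.map_comp, s.hom_p, CategoryTheory.Functor.map_id]

/-- A dependent projection that is a homotopy equivalence has contractible fibers. Transport along
the homotopy `g ≫ p B ∼ 𝟙` turns a homotopy inverse `g` into a section `s`. Then, as
`Id x (s (p x))` is a type over `x : Γ.B` with the term `refl` at `x = s y`, transport along the
homotopy `p B ≫ s ∼ 𝟙` gives a term at every `x`; no coherence of this homotopy is needed. -/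
theorem isContractible_of_homotopyEquivalences_p [PiTypes C] {Γ : C} {B : Ty Γ}
    (h : homotopyEquivalences C (p B)) : IsContractible B := by
  have h' : IsIso ((toHo C).map (p B)) := h
  obtain ⟨g, hg⟩ := (toHo C).map_surjective (inv ((toHo C).map (p B)))
  have hgp : (toHo C).map (g ≫ p B) = (toHo C).map (𝟙 _) := by
    rw [Functor.map_comp, hg, IsIso.inv_hom_id, CategoryTheory.Functor.map_id]
  obtain ⟨s⟩ := (lifts_id_iff B).1 ((lifts_iff_of_map_eq hgp B).1 ⟨g, rfl⟩)
  have hps : (toHo C).map (p B ≫ s.hom) = (toHo C).map (𝟙 _) := by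
    rw [← cancel_mono ((toHo C).map (p B)), ← Functor.map_comp, ← Functor.map_comp, Category.assoc,
      s.hom_p, Category.comp_id, Category.id_comp]
  refine ⟨s, ?_⟩
  -- rewrite the goal as a term, over `x : Γ.B`, of the type `Id x (s (p x))`
  rw [← Category.id_comp (pair₂ _ _ _), ← lifts_sub_iff, ← lifts_iff_of_map_eq hps, lifts_sub_iff]
  have e : (p B ≫ s.hom) ≫ p B ≫ s.hom = p B ≫ s.hom := by
    rw [Category.assoc, ← Category.assoc s.hom, s.hom_p, Category.id_comp]
  convert lifts_pair₂_self (A := B) (a := p B ≫ s.hom) rfl rfl using 1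
  refine eq_pair₂ ?_ ?_ _
  · rw [Category.assoc, pair₂_p, Category.comp_id]
  · rw [Category.assoc, pair₂_q, e]

theorem isContractible_iff [PiTypes C] {Γ : C} (B : Ty Γ) :
    IsContractible B ↔ homotopyEquivalences C (p B) :=
  ⟨fun h => h.homotopyEquivalences_p, isContractible_of_homotopyEquivalences_p⟩

end Contractible

/-! ### Acyclic fibrations -/

section Acyclic

variable {C : Type u} [Category.{v} C] [ContextualCategory.{w} C]

theorem homotopyEquivalences_of_anodyne {X Y : C} {i : X ⟶ Y} (hi : anodyne C i) :
    homotopyEquivalences C i :=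
  homotopyEquivalences_of_anodyne_of_tower hi (ContextualCategory.tower X)

theorem fibrations_toOne (X : C) : fibrations C (toOne X) :=
  fibrations_of_multiplicativeClosure
    (multiplicativeClosure_toOne_of_tower (ContextualCategory.tower X))

variable [PiTypes C] [SigmaTypes C] [IdTypes C]

/-- Acyclic fibrations are stable under pullback, because contractibility of a type is stable under
substitution, and an acyclic fibration is a retract of the projection from a contractible type. -/
theorem homotopyEquivalences_of_isPullback {P X Y Z : C} {p₁ : P ⟶ X} {p₂ : P ⟶ Y} {f : X ⟶ Z}
    {g : Y ⟶ Z} (h : IsPullback p₁ p₂ f g) (hg : fibrations C g)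
    (hg' : homotopyEquivalences C g) : homotopyEquivalences C p₁ := by
  obtain ⟨Y', e, g', hgf, rfl⟩ := (fibrations_iff g).1 hg
  obtain hi | ⟨S, i, hi, rfl⟩ := exists_anodyne_comp_p hgf
  · have := h.isIso_fst_of_isIso
    exact homotopyEquivalences_of_isIso _
  have hS : homotopyEquivalences C (p S) :=
    MorphismProperty.of_precomp _ _ _ (homotopyEquivalences_of_anodyne hi)
      (MorphismProperty.of_precomp _ _ _ (homotopyEquivalences_of_isIso e.hom) hg')
  have hSf := (((isContractible_iff S).2 hS).sub f).homotopyEquivalences_p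
  have := hasLiftingProperty_of_anodyne hi hgf
  -- `j` and `r` are the pullbacks along `f` of `i` and of its retraction over `Z`
  have sq : CommSq (𝟙 _) i (i ≫ p S) (p S) := ⟨Category.id_comp _⟩
  let j : P ⟶ ext (sub S f) := pair f S (p₂ ≫ e.hom ≫ i) p₁ (by
    rw [h.w, Category.assoc, Category.assoc])
  let r : ext (sub S f) ⟶ P := h.lift (p _) (q f S ≫ sq.lift ≫ e.inv) (by
    rw [Category.assoc, Category.assoc, e.inv_hom_id_assoc, sq.fac_right, q_p])
  have hj : j ≫ p _ = p₁ := pair_p _ _ _ _ _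
  have hr : r ≫ p₁ = p _ := h.lift_fst _ _ _
  have hjr : j ≫ r = 𝟙 _ := by
    refine h.hom_ext ?_ ?_
    · rw [Category.assoc, hr, hj, Category.id_comp]
    · have hjq : j ≫ q f S = p₂ ≫ e.hom ≫ i := pair_q _ _ _ _ _
      have hl : i ≫ sq.lift = 𝟙 _ := sq.fac_left
      rw [Category.assoc, h.lift_snd, ← Category.assoc, hjq]
      simp [reassoc_of% hl]
  refine MorphismProperty.of_retract (P := homotopyEquivalences C) (f := p₁) (g := p (sub S f))
    ?_ hSf
  exact { i := Arrow.homMk j (𝟙 _) (by simp [hj]), r := Arrow.homMk r (𝟙 _) (by simp [hr]),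
          retract := by ext <;> simp [hjr] }

end Acyclic

/-! ### Path spaces and mapping path spaces -/

section PathSpaces

variable {C : Type u} [Category.{v} C]

theorem lifts_IdTy [ContextStructure.{w} C] [IdTypes C] {W V Γ : C} {A : Ty Γ} {a b : V ⟶ ext A}
    (h : a ≫ p A = b ≫ p A) {l : W ⟶ V} (e : l ≫ a = l ≫ b) : Lifts l (IdTy a b h) := by
  rw [IdTy, lifts_sub_iff]
  convert lifts_pair₂_self e (by rw [Category.assoc, h, Category.assoc]) using 1
  exact eq_pair₂ (by rw [Category.assoc, pair₂_p]) (by rw [Category.assoc, pair₂_q]) _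

theorem isPullback_p_q [ContextStructure.{w} C] (T : Ty (one : C)) (X : C) :
    IsPullback (p (sub T (toOne X))) (q (toOne X) T) (toOne X) (toOne (ext T)) := by
  rw [toOne_ext (toOne (ext T)) (p T)]
  exact (isPullback (toOne X) T).flip

theorem isPullback_p_q_closed [ContextStructure.{w} C] (T : Ty (one : C)) :
    IsPullback (p (sub T (p T))) (q (p T) T) (toOne _) (toOne _) := by
  rw [toOne_ext (p T) (toOne _)]
  exact isPullback_p_q T _

variable [ContextualCategory.{w} C] [PiTypes C] [SigmaTypes C] [IdTypes C]

/-- An endpoint projection of the path space of `T` is an acyclic fibration, hence so is its pullback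
along a map `f : X ⟶ T`. The endpoint is given by one projection `e` from `T × T` to `T`, with `e'`
the other one, and `V` is a product of `X` and `T`. -/
theorem homotopyEquivalences_sub_IdF {T : Ty (one : C)} {X V : C}
    {e e' : ext (sub T (p T)) ⟶ ext T} (he : IsPullback e' e (toOne _) (toOne _))
    (hfib : fibrations C e) (hrefl : refl T ≫ p (IdF T) ≫ e = 𝟙 _) {f : X ⟶ ext T}
    {π : V ⟶ X} {m : V ⟶ ext (sub T (p T))} (hm : m ≫ e = π ≫ f)
    (hV : IsPullback π (m ≫ e') (toOne _) (toOne _)) :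
    homotopyEquivalences C (p (sub (IdF T) m) ≫ π) := by
  have h₁ : IsPullback m π e f := by
    refine IsPullback.of_right ?_ hm he
    rw [toOne_ext (f ≫ _) (toOne _)]
    exact hV.flip
  have h₂ := ((isPullback m (IdF T)).paste_vert h₁).flip
  refine homotopyEquivalences_of_isPullback h₂ (fibrations_comp (fibrations_p _) hfib) ?_
  refine MorphismProperty.of_precomp _ _ _ (homotopyEquivalences_of_anodyne (anodyne_refl T)) ?_
  rw [hrefl]
  exact homotopyEquivalences_of_isIso _

variable {T : Ty (one : C)} {X V : C} {π₁ : V ⟶ X} {π₂ : V ⟶ ext T}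

/-- The mapping path space of `f`, consisting of `x`, `y` and a path from `f x` to `y`, is equivalent
to `X`. -/
theorem homotopyEquivalences_mappingPath (hV : IsPullback π₁ π₂ (toOne _) (toOne _))
    (f : X ⟶ ext T) (h : (π₁ ≫ f) ≫ p T = π₂ ≫ p T) :
    homotopyEquivalences C (p (IdTy (π₁ ≫ f) π₂ h) ≫ π₁) :=
  homotopyEquivalences_sub_IdF (isPullback_p_q_closed T).flip (fibrations_p _) (refl_p_p T)
    (pair₂_p _ _ _) (by rwa [pair₂_q])

/-- The variant of `homotopyEquivalences_mappingPath` with paths from `y` to `f x`. -/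
theorem homotopyEquivalences_mappingPath' (hV : IsPullback π₁ π₂ (toOne _) (toOne _))
    (f : X ⟶ ext T) (h : π₂ ≫ p T = (π₁ ≫ f) ≫ p T) :
    homotopyEquivalences C (p (IdTy π₂ (π₁ ≫ f) h) ≫ π₁) :=
  homotopyEquivalences_sub_IdF (isPullback_p_q_closed T)
    (fibrations_of_isPullback (isPullback (p T) T) (fibrations_p _)) (refl_p_q T)
    (pair₂_q _ _ _) (by rwa [pair₂_p])

/-- The projection `π₂` from the mapping path space of `f`, restricted along a section of the
homotopy equivalence to `X`, is `f`. So the mapping path space factors `f` as a homotopy equivalence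
followed by the projection to `T`. -/
theorem homotopyEquivalences_mappingPath_iff (hV : IsPullback π₁ π₂ (toOne _) (toOne _))
    (f : X ⟶ ext T) (h : (π₁ ≫ f) ≫ p T = π₂ ≫ p T) :
    homotopyEquivalences C (p (IdTy (π₁ ≫ f) π₂ h) ≫ π₂) ↔ homotopyEquivalences C f := by
  have h₁ : hV.lift (𝟙 X) f (toOne_ext _ _) ≫ π₁ = 𝟙 X := hV.lift_fst _ _ _
  have h₂ : hV.lift (𝟙 X) f (toOne_ext _ _) ≫ π₂ = f := hV.lift_snd _ _ _
  obtain ⟨j, hj⟩ : Lifts (hV.lift (𝟙 X) f (toOne_ext _ _)) (IdTy (π₁ ≫ f) π₂ h) :=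
    lifts_IdTy h (by rw [← Category.assoc, h₁, h₂, Category.id_comp])
  have hj' : homotopyEquivalences C j := by
    refine MorphismProperty.of_postcomp _ _ _ (homotopyEquivalences_mappingPath hV f h) ?_
    rw [← Category.assoc, hj, h₁]
    exact homotopyEquivalences_of_isIso _
  have hjf : j ≫ p (IdTy (π₁ ≫ f) π₂ h) ≫ π₂ = f := by rw [← Category.assoc, hj, h₂]
  conv_rhs => rw [← hjf]
  exact ⟨fun h' => MorphismProperty.comp_mem _ _ _ hj' h',
    fun h' => MorphismProperty.of_precomp _ _ _ hj' h'⟩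

end PathSpaces

/-! ### Comparison of weak equivalences with homotopy equivalences -/

section Equivalences

variable {C : Type u} [Category.{v} C]

theorem nonempty_tm_Pi_iff [ContextStructure.{w} C] [PiTypes C] {Γ : C} (A : Ty Γ)
    (B : Ty (ext A)) :
    Nonempty (Tm (Pi A B)) ↔ Nonempty (Tm B) :=
  ⟨fun ⟨k⟩ => ⟨ev k⟩, fun ⟨b⟩ => ⟨lam b⟩⟩

section

variable [ContextStructure.{w} C] [SigmaTypes C]

theorem fst_p {Γ : C} (A : Ty Γ) (B : Ty (ext A)) : fst A B ≫ p A = p (Sig A B) := by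
  rw [fst, Category.assoc, q_p, ← Category.assoc, Tm.hom_p, Category.id_comp]

theorem untuple_p {Γ : C} (A : Ty Γ) (B : Ty (ext A)) : untuple A B ≫ p B = fst A B := by
  rw [untuple, Category.assoc, q_p, ← Category.assoc, Tm.hom_p, Category.id_comp]

theorem nonempty_tm_Sig_iff {Γ : C} (A : Ty Γ) (B : Ty (ext A)) :
    Nonempty (Tm (Sig A B)) ↔ ∃ s : Tm A, Lifts s.hom B := by
  constructor
  · rintro ⟨t⟩
    exact ⟨⟨t.hom ≫ fst A B, by rw [Category.assoc, fst_p, t.hom_p]⟩, t.hom ≫ untuple A B,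
      by rw [Category.assoc, untuple_p]⟩
  · rintro ⟨s, e, he⟩
    exact ⟨⟨e ≫ tuple A B, by rw [Category.assoc, tuple_p, ← Category.assoc, he, s.hom_p]⟩⟩

/-- Once the center `s` has been substituted, `isContr A` takes `x : A` in the context `Γ.A[p][s]`,
whereas `IsContractible A` takes it in the isomorphic context `Γ.A`. -/
theorem nonempty_tm_isContr_iff [PiTypes C] [IdTypes C] {Γ : C} (A : Ty Γ) :
    Nonempty (Tm (isContr A)) ↔ IsContractible A := by
  rw [isContr, nonempty_tm_Sig_iff]
  refine exists_congr fun s => ?_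
  conv_lhs => rw [← Category.id_comp s.hom, ← lifts_sub_iff, lifts_id_iff, Pi_sub,
    nonempty_tm_Pi_iff, ← lifts_id_iff, lifts_sub_iff, Category.id_comp, IdTy, lifts_sub_iff]
  constructor
  · intro h
    have h₀ : (p A ≫ s.hom) ≫ p A = 𝟙 _ ≫ p A := by
      rw [Category.assoc, s.hom_p, Category.id_comp, Category.comp_id]
    obtain ⟨e, he⟩ : ∃ e : ext A ⟶ ext (sub (sub A (p A)) s.hom),
        e ≫ q s.hom _ = pair₂ (p A ≫ s.hom) (𝟙 _) h₀ :=
      ⟨_, pair_q _ _ _ (p A) (pair₂_p _ _ h₀)⟩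
    convert h.precomp e using 1
    symm
    refine eq_pair₂ ?_ ?_ _
    · rw [Category.assoc, Category.assoc, pair₂_p, ← Category.assoc, he, pair₂_q]
    · rw [Category.assoc, Category.assoc, pair₂_q, ← Category.assoc, he, pair₂_p]
  · intro h
    convert h.precomp (q s.hom (sub A (p A)) ≫ q (p A) A) using 1
    refine (isPullback (p A) A).hom_ext ?_ ?_
    · have h₁ : (q s.hom (sub A (p A)) ≫ q (p A) A) ≫ p A = p _ := by
        rw [Category.assoc, q_p, ← Category.assoc, q_p, Category.assoc, s.hom_p, Category.comp_id]
      rw [Category.assoc, Category.assoc, pair₂_q, pair₂_q, ← Category.assoc, h₁, q_p]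
    · rw [Category.assoc, Category.assoc, pair₂_p, pair₂_p, Category.comp_id]

end

/-- `isEquiv f` says that `hfib f` is contractible over `B`, that is, that its projection to `B` is
a homotopy equivalence. As `tuple` is an anodyne map over `B` from the mapping path space of `f` to
`hfib f`, this holds if and only if `f` is a homotopy equivalence. -/
theorem nonempty_tm_isEquiv_iff [ContextualCategory.{w} C] [PiTypes C] [SigmaTypes C] [IdTypes C]
    {A B : Ty (one : C)} (f : ext A ⟶ ext B) :
    Nonempty (Tm (isEquiv f)) ↔ homotopyEquivalences C f := by
  have hV := (isPullback_p_q A (ext B)).flip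
  rw [isEquiv, nonempty_tm_Pi_iff, nonempty_tm_isContr_iff, isContractible_iff,
    ← homotopyEquivalences_mappingPath_iff hV f (toOne_ext _ _)]
  have e : tuple _ _ ≫ p (hfib f) = _ := tuple_p _ _
  rw [← e]
  have h := homotopyEquivalences_of_anodyne
    (anodyne_tuple _ (IdTy (q (toOne (ext B)) A ≫ f) (p (sub A (toOne (ext B)))) (toOne_ext _ _)))
  exact ⟨fun h' => MorphismProperty.comp_mem _ _ _ h h',
    fun h' => MorphismProperty.of_precomp _ _ _ h h'⟩

section

variable [ContextStructure.{w} C] [PiTypes C] [SigmaTypes C] [IdTypes C] [NatIntro C]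

/-- For contexts of length at least one, the tupling map to the iterated `Σ`-type is anodyne. -/
theorem anodyne_packing_pack_snoc : ∀ {Γ : C} (t : Tower Γ) (A : Ty Γ),
    anodyne C (Tower.snoc t A).packing.pack
  | _, .nil, _ => (anodyne C).id_mem _
  | _, .snoc t A, B => by
    refine (anodyne C).comp_mem _ _ (anodyne_of_isPullback (anodyne_packing_pack_snoc t A)
      (g := p B) (IsPullback.of_right (h₁₂ := q _ B) (v₁₃ := p B)
        (h₂₂ := (Tower.snoc t A).packing.unpack) ?_ (pair_p _ _ _ _ _) (isPullback _ _)))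
      (anodyne_tuple _ _)
    rw [pair_q, Packing.pack_unpack]
    exact .of_horiz_isIso ⟨by simp⟩

end

variable [ContextualCategory.{w} C] [PiTypes C] [SigmaTypes C] [IdTypes C] [NatIntro C]

theorem homotopyEquivalences_star : homotopyEquivalences C (star C) := by
  refine MorphismProperty.comp_mem _ _ _ ?_ (homotopyEquivalences_of_anodyne (anodyne_tuple _ _))
  -- `Id n 0` is the pullback along `0` of an endpoint projection from the path space of `N`
  have (g : (one : C) ⟶ one) : IsIso g := isIso_of_isTerminal oneIsTerminal oneIsTerminal g
  have hV : IsPullback (p (NatIntro.N : Ty (one : C))) (𝟙 _) (toOne _) (toOne _) := by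
    exact .of_vert_isIso ⟨toOne_ext _ _⟩
  refine MorphismProperty.of_postcomp _ _ _
    (homotopyEquivalences_mappingPath' hV NatIntro.zero (toOne_ext _ _)) ?_
  exact homotopyEquivalences_of_isIso _

theorem homotopyEquivalences_packing_pack {Γ : C} (t : Tower Γ) :
    homotopyEquivalences C t.packing.pack := by
  cases t with
  | nil => exact homotopyEquivalences_star
  | snoc t A => exact homotopyEquivalences_of_anodyne (anodyne_packing_pack_snoc t A)

/-! ### Path objects and products -/

/-- Every object has a path object: the pullback of the path space of its iterated `Σ`-type `T`
along `X × X ⟶ T × T`. It is formed in two steps, via the mapping path space of `X ⟶ T`. -/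
theorem exists_pathObject (X : C) [HasBinaryProduct X X] :
    ∃ (P : C) (r : X ⟶ P) (π : P ⟶ X ⨯ X),
      homotopyEquivalences C r ∧ fibrations C π ∧ r ≫ π = diag X := by
  obtain ⟨T, k, hk⟩ : ∃ (T : Ty (one : C)) (k : X ⟶ ext T), homotopyEquivalences C k :=
    ⟨_, _, homotopyEquivalences_packing_pack (ContextualCategory.tower X)⟩
  have hV := isPullback_p_q T X
  have hX : IsPullback (prod.fst : X ⨯ X ⟶ X) prod.snd (toOne X) (toOne X) :=
    .of_is_product (limit.isLimit _) oneIsTerminal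
  let I := IdTy (p (sub T (toOne X)) ≫ k) (q (toOne X) T) (toOne_ext _ _)
  let m : X ⨯ X ⟶ ext (sub T (toOne X)) := pair _ _ (prod.snd ≫ k) prod.fst (toOne_ext _ _)
  have hmp : m ≫ p _ = prod.fst := pair_p _ _ _ _ _
  have hmq : m ≫ q _ _ = prod.snd ≫ k := pair_q _ _ _ _ _
  have hm : IsPullback m prod.snd (q (toOne X) T) k := by
    refine .of_right ?_ hmq hV
    rw [hmp, toOne_ext (k ≫ _) (toOne _)]
    exact hX
  obtain ⟨r, hr⟩ : Lifts (diag X) (sub I m) := by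
    refine (lifts_sub_iff _ _ _).2 (lifts_IdTy _ ?_)
    rw [Category.assoc, Category.assoc, hmq, ← Category.assoc m, hmp]
    rw [prod.lift_fst_assoc, prod.lift_snd_assoc]
  refine ⟨_, r, p (sub I m), ?_, fibrations_p _, hr⟩
  have hq : fibrations C (q (toOne X) T) := fibrations_of_isPullback hV.flip (fibrations_toOne X)
  have h := homotopyEquivalences_of_isPullback ((isPullback m I).paste_vert hm).flip
    (fibrations_comp (fibrations_p _) hq)
    ((homotopyEquivalences_mappingPath_iff hV k (toOne_ext _ _)).2 hk)
  refine MorphismProperty.of_postcomp _ _ _ h ?_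
  rw [← Category.assoc, hr, prod.lift_snd]
  exact homotopyEquivalences_of_isIso _

end Equivalences

theorem hasBinaryProduct_of_contextualCategory {C : Type u} [Category.{v} C]
    [ContextualCategory.{w} C] (X Y : C) : HasBinaryProduct X Y := by
  obtain ⟨P, p₁, p₂, h, -⟩ := exists_isPullback_of_fibrations (toOne X) (fibrations_toOne Y)
  exact ⟨⟨_, isProductOfIsTerminalIsPullback _ _ _ _ oneIsTerminal h.isLimit⟩⟩

/-! ### The fibration category -/

theorem isFibrationCategory_homotopyEquivalences (C : Type u) [Category.{v} C]
    [ContextualCategory.{w} C] [PiTypes C] [SigmaTypes C] [IdTypes C] [NatIntro C] :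
    IsFibrationCategory (homotopyEquivalences C) (fibrations C) where
  two_out_of_six := fun _ _ _ => homotopyEquivalences_two_out_of_six
  fibration_comp := fun _ _ => fibrations_comp
  acyclicFibration_of_isIso := fun f _ =>
    ⟨homotopyEquivalences_of_isIso f, fibrations_of_isIso f⟩
  hasTerminal := oneIsTerminal.hasTerminal
  hasPullback := fun f _ hg =>
    let ⟨_, _, _, h, _⟩ := exists_isPullback_of_fibrations f hg
    h.hasPullback
  fibration_pullback := fibrations_of_isPullback
  acyclicFibration_pullback := fun h hg =>
    ⟨homotopyEquivalences_of_isPullback h hg.2 hg.1, fibrations_of_isPullback h hg.2⟩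
  pathObject := fun X =>
    have := hasBinaryProduct_of_contextualCategory X X
    ⟨this, exists_pathObject X⟩
  fibrant := fun {X T} hT => by
    have := isIso_of_isTerminal oneIsTerminal hT (hT.from _)
    rw [hT.hom_ext (hT.from X) (toOne X ≫ hT.from _)]
    exact fibrations_comp (fibrations_toOne X) (fibrations_of_isIso _)

theorem weakEquivalences_eq (C : Type u) [Category.{v} C] [CategoricalModel.{w} C] :
    weakEquivalences C = homotopyEquivalences C := by
  have hu {Γ : C} (t : Tower Γ) : homotopyEquivalences C t.packing.unpack := by
    refine MorphismProperty.of_precomp _ _ _ (homotopyEquivalences_packing_pack t) ?_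
    rw [Packing.pack_unpack]
    exact homotopyEquivalences_of_isIso _
  ext Γ Δ f
  rw [weakEquivalences, nonempty_tm_isEquiv_iff]
  constructor
  · intro h
    exact MorphismProperty.of_postcomp _ _ _ (homotopyEquivalences_packing_pack _)
      (MorphismProperty.of_precomp _ _ _ (hu _) h)
  · intro h
    exact MorphismProperty.comp_mem _ _ _ (hu _)
      (MorphismProperty.comp_mem _ _ _ h (homotopyEquivalences_packing_pack _))

end ModelsOfTypeTheory

theorem theorem2 (C : Type u) [CategoryTheory.Category.{v} C]
    [ModelsOfTypeTheory.CategoricalModel.{w} C] :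
    ModelsOfTypeTheory.IsFibrationCategory (ModelsOfTypeTheory.weakEquivalences C)
      (ModelsOfTypeTheory.fibrations C) := by
  rw [ModelsOfTypeTheory.weakEquivalences_eq]
  exact ModelsOfTypeTheory.isFibrationCategory_homotopyEquivalences C
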